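/- For a finite simple graph $G$, an identifying code of $G$ is a set $C\subseteq V(G)$ such that every vertex outside $C$ has a neighbor in $C$, and $N_G[u]\cap C\neq N_G[v]\cap C$ for all distinct vertices $u,v$, where $N_G[v]$ is the closed neighborhood of $v$. The identifying code number $\gamma^{\mathrm{ID}}(G)$ is the minimum size of an identifying code of $G$ ($\infty$ if there is none). There are absolute constants $M,K_1,K_2>0$ such that the following holds. Let $G$ be a finite simple graph on $n$ vertices with minimum degree $\delta$ and maximum degree $\Delta$ such that $n-\delta\geq M$ (that is, $\delta=n-\omega(1)$) and $n-\Delta\geq 66\log(n-\delta)$, where $\log$ is the natural logarithm. Then there is a set $F$ of pairs of distinct non-adjacent vertices of $G$, of size $|F|\leq K_1\,n\log(n-\delta)$, such that the graph $G\cup F$ obtained from $G$ by adding the edges of $F$ has an identifying code and $\gamma^{\mathrm{ID}}(G\cup F)\leq K_2\,\dfrac{n\log n}{n-\Delta}$. -/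

import Mathlib

namespace SimpleGraph

variable {V : Type*}

/-- The closed neighborhood `N[v] = N(v) ∪ {v}` of a vertex. -/
def closedNeighborhood (G : SimpleGraph V) (v : V) : Set V :=
  G.neighborSet v ∪ {v}

/-- `C` is a dominating set: each vertex outside `C` has a neighbor in `C`. -/
def IsDominatingSet (G : SimpleGraph V) (C : Set V) : Prop :=
  ∀ v, v ∉ C → ∃ c ∈ C, G.Adj v c

/-- `C` is a separating set: distinct vertices have distinct closed neighborhoods within `C`. -/
def IsSeparatingSet (G : SimpleGraph V) (C : Set V) : Prop :=
  ∀ u v, u ≠ v → G.closedNeighborhood u ∩ C ≠ G.closedNeighborhood v ∩ C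

/-- An identifying code is a set of vertices that is both dominating and separating. -/
def IsIdentifyingCode (G : SimpleGraph V) (C : Set V) : Prop :=
  G.IsDominatingSet C ∧ G.IsSeparatingSet C

/-- The identifying code number: the minimum size of an identifying code of `G`. It is `⊤` if `G`
has no (finite) identifying code, which happens exactly when a finite `G` has twins. -/
noncomputable def identifyingCodeNumber (G : SimpleGraph V) : ℕ∞ :=
  ⨅ (C : Finset V) (_ : G.IsIdentifyingCode (C : Set V)), (C.card : ℕ∞)

/-- The graph `G ∪ F` obtained from `G` by adding the edges in `F`. -/
def addEdges (G : SimpleGraph V) (F : Set (Sym2 V)) : SimpleGraph V :=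
  G ⊔ fromEdgeSet F

end SimpleGraph

/-!
Adding edges to `G` is deleting edges from its complement `H`, whose degrees lie between
`d = n - 1 - Δ` and `D = n - 1 - δ`. Closed neighbourhoods in `G ∪ F` are complements of open
neighbourhoods in `H \ F`, so a code `C` is wanted on which the open neighbourhoods in `H \ F`
are pairwise distinct. It will also be dominating if each vertex loses an edge to `C`.

Colour the vertices with `m`, about `d / (22 log (D + 1))`, colours such that each vertex has in each
colour class at least `s`, about `2 log₂ (D + 1)`, neighbours. Such a colouring exists by the
local lemma (`exists_coloring_forall_frequent`), since a random colouring fails at a given vertex with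
probability below `1 / (4 D²)` and failures at vertices without common neighbours are independent.
By averaging, three consecutive colour classes contain at most `3n / m` vertices together, and
these form the code (`exists_rotation_le`).

The edges are deleted by a deterministic argument (`exists_separating_deletion`). Call the three
classes `a`, `b`, `c`. A vertex in `a` may delete edges to `b`, one in `b` edges to `c`, one in `c`
edges to `a`, and every other vertex edges to `a`. No edge is then controlled by both its ends.
Each vertex has `2 ^ s` ways to choose what remains of its neighbourhood in its target class. It has
to avoid the at most `D ^ 2 + 1` sets which could be confused with the fixed neighbourhoods of
vertices with another target, and vertices with the same target need distinct choices. Both can be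
achieved by Hall's theorem, because a nonempty set is a possible choice for at most `D` vertices.
-/

namespace SimpleGraph

open Finset

/-! ### A local lemma for uniformly random colourings -/

open Classical in
/-- For a uniformly random colouring, an event determined by the colours on `A` is independent of
an event determined by the colours off `A`. The proof exchanges the colours off `A` within pairs
of colourings. -/
theorem card_filter_and_mul_card {V α : Type*} [Fintype V] [Fintype α] (A : Finset V)
    (P Q : (V → α) → Prop) (hP : ∀ f g, (∀ w ∈ A, f w = g w) → (P f ↔ P g))
    (hQ : ∀ f g, (∀ w ∉ A, f w = g w) → (Q f ↔ Q g)) :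
    #{f | P f ∧ Q f} * Fintype.card (V → α) = #{f | P f} * #{f | Q f} := by
  rw [← card_univ, ← card_product, ← card_product]
  have h1 (f g : V → α) : P (A.piecewise f g) ↔ P f :=
    hP _ _ fun w hw => by simp [hw]
  have h2 (f g : V → α) : Q (A.piecewise g f) ↔ Q f :=
    hQ _ _ fun w hw => by simp [hw]
  refine card_nbij' (fun x => (A.piecewise x.1 x.2, A.piecewise x.2 x.1))
    (fun x => (A.piecewise x.1 x.2, A.piecewise x.2 x.1)) ?_ ?_ ?_ ?_
  · rintro ⟨f, g⟩ h
    simp only [coe_product, coe_filter, mem_univ, true_and, Set.mem_prod, Set.mem_ofPred_eq,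
      h1, h2] at h ⊢
    exact h.1
  · rintro ⟨f, g⟩ h
    simp only [coe_product, coe_filter, mem_univ, true_and, Set.mem_prod, Set.mem_ofPred_eq,
      h1, h2, coe_univ, Set.mem_univ, and_true] at h ⊢
    exact h
  · rintro ⟨f, g⟩ -
    ext w <;> by_cases hw : w ∈ A <;> simp [hw]
  · rintro ⟨f, g⟩ -
    ext w <;> by_cases hw : w ∈ A <;> simp [hw]

open Classical in
/-- The inductive step of the local lemma: if each bad event `B v` depends only on the colours on
`N v`, has probability at most `1 / (4k)`, and is linked to at most `k` others, then conditioning on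
the avoidance of the events in `S` raises the probability of `B v` to at most `1 / (2k)`. -/
theorem two_mul_card_bad_le {V α : Type*} [Fintype V] [Fintype α] (N : V → Finset V)
    (B : V → (V → α) → Prop) (hB : ∀ v f g, (∀ w ∈ N v, f w = g w) → (B v f ↔ B v g))
    {k : ℕ} (hk : ∀ v, #{u | ¬Disjoint (N u) (N v)} ≤ k)
    (hp : ∀ v, 4 * k * #{f | B v f} ≤ Fintype.card (V → α)) (S : Finset V) (v : V) :
    2 * k * #{f | B v f ∧ ∀ u ∈ S, ¬B u f} ≤ #{f | ∀ u ∈ S, ¬B u f} := by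
  induction S using Finset.strongInduction generalizing v with
  | H S ih =>
  set T := S.filter fun u => Disjoint (N u) (N v)
  set R := S.filter fun u => ¬Disjoint (N u) (N v)
  have hTS : T ⊆ S := filter_subset _ _
  set g := #{f : V → α | ∀ u ∈ T, ¬B u f}
  -- By induction each of the at most `k` events in `R` has conditional probability at most
  -- `1 / (2k)` given that `T` is avoided, so avoiding `R` too costs at most half.
  have h1 : g ≤ 2 * #{f : V → α | ∀ u ∈ S, ¬B u f} := by
    rcases hTS.eq_or_ssubset with h | h
    · simp only [g, h]; omega
    · have hsub : ({f : V → α | ∀ u ∈ T, ¬B u f} : Finset _) ⊆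
          ({f | ∀ u ∈ S, ¬B u f} : Finset _) ∪ R.biUnion fun u => {f | B u f ∧ ∀ u ∈ T, ¬B u f} := by
        intro f hf
        simp only [mem_union, mem_biUnion, mem_filter, mem_univ, true_and] at hf ⊢
        by_cases hS : ∀ u ∈ S, ¬B u f
        · exact Or.inl hS
        · push Not at hS
          obtain ⟨u, hu, hb⟩ := hS
          refine Or.inr ⟨u, ?_, hb, hf⟩
          by_contra hR
          refine hf u ?_ hb
          simp only [R, T, mem_filter, hu, true_and, not_not] at hR ⊢
          exact hR
      have hR : #R ≤ k := (card_le_card (filter_subset_filter _ (subset_univ S))).trans (hk v)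
      have h3 := (card_le_card hsub).trans ((card_union_le _ _).trans
        (Nat.add_le_add_left card_biUnion_le _))
      have h4 : 2 * k * ∑ u ∈ R, #{f | B u f ∧ ∀ u ∈ T, ¬B u f} ≤ k * g := by
        rw [mul_sum]
        calc _ ≤ ∑ u ∈ R, g := sum_le_sum fun u _ => ih T h u
          _ = #R * g := by simp
          _ ≤ k * g := Nat.mul_le_mul_right _ hR
      rcases Nat.eq_zero_or_pos k with h0 | h0
      · have : R = ∅ := by rw [← card_eq_zero]; omega
        rw [this] at h3
        simp at h3
        change g ≤ _ at h3
        omega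
      · have : 2 * (∑ u ∈ R, #{f | B u f ∧ ∀ u ∈ T, ¬B u f}) ≤ g := by
          refine Nat.le_of_mul_le_mul_left ?_ h0
          linarith
        change g ≤ _ at h3
        omega
  have h2 : #{f | B v f ∧ ∀ u ∈ T, ¬B u f} * Fintype.card (V → α) = #{f | B v f} * g := by
    convert card_filter_and_mul_card (N v) (B v) (fun f => ∀ u ∈ T, ¬B u f) (hB v) fun f f' h => ?_
    refine forall₂_congr fun u hu => not_congr (hB u _ _ fun w hw => h w ?_)
    exact Finset.disjoint_left.1 (mem_filter.1 hu).2 hw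
  have h3 : #{f | B v f ∧ ∀ u ∈ S, ¬B u f} ≤ #{f | B v f ∧ ∀ u ∈ T, ¬B u f} :=
    card_le_card fun f hf => by
      simp only [mem_filter, mem_univ, true_and] at hf ⊢
      exact ⟨hf.1, fun u hu => hf.2 u (hTS hu)⟩
  have h4 : 4 * k * #{f | B v f ∧ ∀ u ∈ T, ¬B u f} ≤ g := by
    rcases Nat.eq_zero_or_pos (Fintype.card (V → α)) with h0 | h0
    · have : IsEmpty (V → α) := Fintype.card_eq_zero_iff.1 h0
      simp [univ_eq_empty]
    · refine Nat.le_of_mul_le_mul_right ?_ h0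
      have h5 := Nat.mul_le_mul_right g (hp v)
      rw [mul_assoc, ← h2, ← mul_assoc, mul_comm _ g] at h5
      exact h5
  have h5 := Nat.mul_le_mul_left (4 * k) h3
  have h6 : 2 * (2 * k * #{f | B v f ∧ ∀ u ∈ S, ¬B u f}) =
      4 * k * #{f | B v f ∧ ∀ u ∈ S, ¬B u f} := by ring
  omega

open Classical in
/-- A symmetric Lovász local lemma: bad events of probability at most `1 / (4k)`, each determined by
the colours on a set `N v` that meets at most `k` of the sets `N u`, can be avoided together. -/
theorem exists_forall_not_of_local {V α : Type*} [Fintype V] [Fintype α] [Nonempty α]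
    (N : V → Finset V) (B : V → (V → α) → Prop)
    (hB : ∀ v f g, (∀ w ∈ N v, f w = g w) → (B v f ↔ B v g))
    {k : ℕ} (hk0 : 0 < k) (hk : ∀ v, #{u | ¬Disjoint (N u) (N v)} ≤ k)
    (hp : ∀ v, 4 * k * #{f | B v f} ≤ Fintype.card (V → α)) :
    ∃ f, ∀ v, ¬B v f := by
  have key (S : Finset V) : 0 < #{f : V → α | ∀ u ∈ S, ¬B u f} := by
    induction S using Finset.induction_on with
    | empty => simpa using Fintype.card_pos (α := V → α)
    | insert v S _ ih =>
      have h1 := two_mul_card_bad_le N B hB hk hp S v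
      have h2 : #{f | ∀ u ∈ S, ¬B u f} =
          #{f | B v f ∧ ∀ u ∈ S, ¬B u f} + #{f | ∀ u ∈ insert v S, ¬B u f} := by
        rw [← card_filter_add_card_filter_not (s := {f | ∀ u ∈ S, ¬B u f}) (fun f => B v f)]
        simp only [filter_filter, forall_mem_insert, and_comm]
      have h3 : 2 * #{f | B v f ∧ ∀ u ∈ S, ¬B u f} ≤
          2 * k * #{f | B v f ∧ ∀ u ∈ S, ¬B u f} :=
        Nat.mul_le_mul_right _ (by omega)
      omega
  obtain ⟨f, hf⟩ := card_pos.1 (key univ)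
  exact ⟨f, fun v => (mem_filter.1 hf).2 v (mem_univ v)⟩

/-! ### Colourings in which every neighbourhood sees every colour often -/

open Classical in
/-- A bound on the probability that some colour occurs fewer than `s` times on `A`: for a colour with
`X` occurrences use Markov's inequality for `2 ^ (-X)`, whose mean is `(1 - 1 / (2m)) ^ #A` with
`m` the number of colours, and then a union bound over the colours. -/
theorem card_exists_rare_color_le {V α : Type*} [Fintype V] [Fintype α] [DecidableEq α]
    [Nonempty α]
    (A : Finset V) (s : ℕ) :
    (#{f : V → α | ∃ i, #{w ∈ A | f w = i} < s} : ℝ) ≤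
      Fintype.card α * 2 ^ s * (1 - 1 / (2 * Fintype.card α)) ^ #A * Fintype.card (V → α) := by
  have hm : (0 : ℝ) < Fintype.card α := by exact_mod_cast Fintype.card_pos
  set m : ℝ := (Fintype.card α : ℝ) with hmdef
  have h1 (i : α) : (#{f : V → α | #{w ∈ A | f w = i} < s} : ℝ) ≤
      2 ^ s * (1 - 1 / (2 * m)) ^ #A * Fintype.card (V → α) := by
    have hsum (w : V) : ∑ c : α, (if w ∈ A ∧ c = i then (1 / 2 : ℝ) else 1) =
        m * if w ∈ A then 1 - 1 / (2 * m) else 1 := by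
      by_cases hw : w ∈ A
      · have h (c : α) : (if w ∈ A ∧ c = i then (1 / 2 : ℝ) else 1) =
            1 - if c = i then 1 / 2 else 0 := by
          by_cases hc : c = i <;> norm_num [hw, hc]
        rw [sum_congr rfl fun c _ => h c, sum_sub_distrib]
        simp only [hw, sum_ite_eq', mem_univ, if_true, sum_const, card_univ, nsmul_eq_mul, mul_one]
        rw [← hmdef]
        field_simp
      · simp [hw, m]
    have h2 : ∑ f : V → α, (1 / 2 : ℝ) ^ #{w ∈ A | f w = i} =
        (1 - 1 / (2 * m)) ^ #A * Fintype.card (V → α) := by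
      have h3 (f : V → α) : (1 / 2 : ℝ) ^ #{w ∈ A | f w = i} =
          ∏ w, if w ∈ A ∧ f w = i then (1 / 2 : ℝ) else 1 := by
        rw [← prod_filter, prod_const]
        congr 2
        ext; simp
      simp_rw [h3]
      rw [← Fintype.prod_sum fun (w : V) (c : α) => if w ∈ A ∧ c = i then (1 / 2 : ℝ) else 1,
        prod_congr rfl fun w _ => hsum w, prod_mul_distrib, ← prod_filter]
      simp [m, mul_comm]
    rw [mul_assoc, ← h2, mul_sum, card_eq_sum_ones, Nat.cast_sum]
    refine (sum_le_sum fun f hf => ?_).trans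
      (sum_le_sum_of_subset_of_nonneg (subset_univ _) fun f _ _ => by positivity)
    have hf := (mem_filter.1 hf).2
    rw [one_div, inv_pow, ← div_eq_mul_inv, Nat.cast_one, one_le_div (by positivity)]
    exact pow_le_pow_right₀ one_le_two hf.le
  have h2 : ({f : V → α | ∃ i, #{w ∈ A | f w = i} < s} : Finset _) ⊆
      univ.biUnion fun i => {f | #{w ∈ A | f w = i} < s} := by
    intro f hf; simpa using hf
  calc (#{f : V → α | ∃ i, #{w ∈ A | f w = i} < s} : ℝ)
      ≤ ∑ i : α, (#{f : V → α | #{w ∈ A | f w = i} < s} : ℝ) := by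
        exact_mod_cast (card_le_card h2).trans card_biUnion_le
    _ ≤ ∑ i : α, 2 ^ s * (1 - 1 / (2 * m)) ^ #A * (Fintype.card (V → α) : ℝ) :=
        sum_le_sum fun i _ => h1 i
    _ = _ := by simp [m]; ring

theorem exists_coloring_forall_frequent {V α : Type*} [Fintype V] [Fintype α]
    [DecidableEq α] [Nonempty α] (H : SimpleGraph V) [DecidableRel H.Adj] {d D s : ℕ} (hD : 0 < D)
    (hdeg : ∀ v, d ≤ H.degree v ∧ H.degree v ≤ D)
    (hp : 4 * (D : ℝ) ^ 2 *
      (Fintype.card α * 2 ^ s * (1 - 1 / (2 * Fintype.card α)) ^ d) ≤ 1) :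
    ∃ χ : V → α, ∀ v i, s ≤ #{w ∈ H.neighborFinset v | χ w = i} := by
  classical
  have := exists_forall_not_of_local (α := α) (fun v => H.neighborFinset v)
    (fun v f => ∃ i, #{w ∈ H.neighborFinset v | f w = i} < s) ?_ (k := D ^ 2) (by positivity) ?_ ?_
  · simpa using this
  · intro v f g h
    refine exists_congr fun i => ?_
    rw [filter_congr fun w hw => by rw [h w hw]]
  · intro v
    have : ({u | ¬Disjoint (H.neighborFinset u) (H.neighborFinset v)} : Finset V) ⊆
        (H.neighborFinset v).biUnion fun w => H.neighborFinset w := by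
      intro u hu
      simp only [mem_filter, mem_univ, true_and, not_disjoint_iff] at hu
      obtain ⟨w, h1, h2⟩ := hu
      refine mem_biUnion.2 ⟨w, h2, ?_⟩
      simpa [adj_comm] using h1
    refine (card_le_card this).trans ((card_biUnion_le_card_mul _ _ D fun w _ => ?_).trans ?_)
    · simpa using (hdeg w).2
    · rw [pow_two]; exact Nat.mul_le_mul_right _ (by simpa using (hdeg v).2)
  · intro v
    have h1 := card_exists_rare_color_le (α := α) (H.neighborFinset v) s
    have hm : (1 : ℝ) ≤ Fintype.card α := by exact_mod_cast Fintype.card_pos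
    set m : ℝ := (Fintype.card α : ℝ)
    have h0 : 0 ≤ 1 - 1 / (2 * m) := by
      rw [sub_nonneg, div_le_one (by positivity)]; linarith
    have h2 : (1 - 1 / (2 * m)) ^ #(H.neighborFinset v) ≤ (1 - 1 / (2 * m)) ^ d :=
      pow_le_pow_of_le_one h0 (by simp; positivity) (by simpa using (hdeg v).1)
    have : (4 * (D : ℝ) ^ 2 * (#{f : V → α | ∃ i, #{w ∈ H.neighborFinset v | f w = i} < s} : ℝ)) ≤
        Fintype.card (V → α) := by
      calc _ ≤ 4 * (D : ℝ) ^ 2 * (m * 2 ^ s * (1 - 1 / (2 * m)) ^ d * Fintype.card (V → α)) := by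
            gcongr
            exact h1.trans (by gcongr)
        _ = 4 * (D : ℝ) ^ 2 * (m * 2 ^ s * (1 - 1 / (2 * m)) ^ d) * Fintype.card (V → α) := by ring
        _ ≤ 1 * Fintype.card (V → α) := by gcongr
        _ = _ := one_mul _
    convert (show 4 * D ^ 2 * #{f : V → α | ∃ i, #{w ∈ H.neighborFinset v | f w = i} < s} ≤
      Fintype.card (V → α) from mod_cast this)

/-! ### Deleting few edges to make neighbourhoods distinct -/

/-- Hall's theorem for a set system in which every index has at least `k` candidates and every
candidate belongs to at most `k` indices. -/
theorem exists_injective_of_card_le {ι β : Type*} [Fintype ι] [DecidableEq β] (P : ι → Finset β)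
    {k : ℕ} (hk : 0 < k) (h1 : ∀ u, k ≤ #(P u)) (h2 : ∀ x, #{u | x ∈ P u} ≤ k) :
    ∃ E : ι → β, Function.Injective E ∧ ∀ u, E u ∈ P u := by
  refine (all_card_le_biUnion_card_iff_exists_injective P).1 fun S => ?_
  have := card_mul_le_card_mul (s := S) (t := S.biUnion P) (fun u x => x ∈ P u) (m := k) (n := k)
    (fun u hu => ?_) (fun x _ => ?_)
  · exact Nat.le_of_mul_le_mul_right this hk
  · refine (h1 u).trans (card_le_card fun x hx => ?_)
    exact mem_filter.2 ⟨mem_biUnion.2 ⟨u, hu, hx⟩, hx⟩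
  · exact (card_le_card (filter_subset_filter _ (subset_univ S))).trans (h2 x)

/-- Let every vertex `v` have at least `s` neighbours in the colour class `τ (χ v)`. Then deleting at
most `s` edges from each `v` to that class makes the neighbourhoods of distinct vertices differ
within the colours in the range of `τ`. As `τ` has no 2-cycle, an edge is at the disposal of at most
one of its endpoints; as `τ ^ 4` has no fixed point, for `τ (χ u) ≠ τ (χ v)` one of the two vertices
has an untouched neighbourhood in the class to which the other one adapts. -/
theorem exists_separating_deletion {V α : Type*} [Fintype V] [DecidableEq V] [DecidableEq α]
    (H : SimpleGraph V) [DecidableRel H.Adj] (χ : V → α) (τ : α → α)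
    (hτ : ∀ i, τ (τ (τ (τ i))) ≠ i) {s D : ℕ} (hD : 0 < D) (hdeg : ∀ v, H.degree v ≤ D)
    (hs : D ^ 2 + D + 1 ≤ 2 ^ s)
    (hχ : ∀ v, s ≤ #{w ∈ H.neighborFinset v | χ w = τ (χ v)}) :
    ∃ F : Finset (Sym2 V), (F : Set (Sym2 V)) ⊆ H.edgeSet ∧ #F ≤ Fintype.card V * s ∧
      (∀ v, ∃ w, χ w = τ (χ v) ∧ s(v, w) ∈ F) ∧
      ∀ u v, u ≠ v → ∃ w, χ w ∈ Set.range τ ∧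
        ¬((H.Adj u w ∧ s(u, w) ∉ F) ↔ (H.Adj v w ∧ s(v, w) ∉ F)) := by
  have hs0 : 0 < s := by
    rcases Nat.eq_zero_or_pos s with rfl | h
    · simp at hs; omega
    · exact h
  -- `Nb v i` is the set of neighbours of `v` of colour `i`.
  let Nb (v : V) (i : α) : Finset V := {w ∈ H.neighborFinset v | χ w = i}
  have hNb (v w : V) (i : α) : w ∈ Nb v i ↔ H.Adj v w ∧ χ w = i := by simp [Nb]
  choose A hA hAs using fun v => exists_subset_card_eq (hχ v)
  change ∀ v, A v ⊆ Nb v (τ (χ v)) at hA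
  -- `E u ∈ P u` will be what remains of `Nb u (τ (χ u))`. It must be nonempty and differ from the
  -- sets `Nb v (τ (χ u))`, which only matters for the at most `D ^ 2` vertices `v` that share a
  -- neighbour with `u`, as otherwise the two sets are disjoint.
  let forb (u : V) : Finset (Finset V) := insert ∅
    (((H.neighborFinset u).biUnion fun w => H.neighborFinset w).image fun v => Nb v (τ (χ u)))
  let P (u : V) : Finset (Finset V) :=
    ((A u).powerset.image fun R => Nb u (τ (χ u)) \ R) \ forb u
  have hforb (u : V) : #(forb u) ≤ D ^ 2 + 1 := by
    refine (card_insert_le _ _).trans (Nat.add_le_add_right (card_image_le.trans ?_) 1)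
    refine (card_biUnion_le_card_mul _ _ D fun w _ => by simpa using hdeg w).trans ?_
    rw [pow_two]; exact Nat.mul_le_mul_right _ (by simpa using hdeg u)
  have hPcard (u : V) : D ≤ #(P u) := by
    have h1 : #((A u).powerset.image fun R => Nb u (τ (χ u)) \ R) = 2 ^ s := by
      rw [card_image_of_injOn, card_powerset, hAs]
      intro R hR R' hR' h
      have hR1 := (mem_powerset.1 (mem_coe.1 hR)).trans (hA u)
      have hR2 := (mem_powerset.1 (mem_coe.1 hR')).trans (hA u)
      rw [← Finset.sdiff_sdiff_eq_self hR1, ← Finset.sdiff_sdiff_eq_self hR2]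
      exact congrArg _ h
    have h2 := le_card_sdiff (forb u) ((A u).powerset.image fun R => Nb u (τ (χ u)) \ R)
    have h3 := hforb u
    change _ ≤ #(P u) at h2
    omega
  -- A nonempty set is a candidate only for the neighbours of its elements, hence at most `D` times.
  obtain ⟨E, hEinj, hE⟩ := exists_injective_of_card_le P hD hPcard fun X => by
    by_cases hX : X = ∅
    · rw [card_eq_zero.2]
      · omega
      · rw [filter_eq_empty_iff]
        rintro u - hu
        exact (mem_sdiff.1 hu).2 (by simp [forb, hX])
    · obtain ⟨w, hw⟩ := nonempty_iff_ne_empty.2 hX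
      refine (card_le_card fun u hu => ?_).trans
        ((H.card_neighborFinset_eq_degree w).trans_le (hdeg w))
      obtain ⟨R, -, rfl⟩ := mem_image.1 (mem_sdiff.1 (mem_filter.1 hu).2).1
      simpa [adj_comm] using ((hNb _ _ _).1 (mem_sdiff.1 hw).1).1
  have hR (u : V) : ∃ R ⊆ A u, Nb u (τ (χ u)) \ R = E u := by
    simpa using (mem_sdiff.1 (hE u)).1
  choose R hRA hRE using hR
  have hRNb (u w : V) (h : w ∈ R u) : H.Adj u w ∧ χ w = τ (χ u) :=
    (hNb _ _ _).1 (hA u (hRA u h))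
  have hE0 (u : V) : E u ≠ ∅ := fun h => (mem_sdiff.1 (hE u)).2 (by simp [forb, h])
  have hEN (u v w : V) (hu : H.Adj u w) (hv : H.Adj v w) : E u ≠ Nb v (τ (χ u)) := fun h =>
    (mem_sdiff.1 (hE u)).2 <| mem_insert_of_mem <| mem_image.2
      ⟨v, mem_biUnion.2 ⟨w, by simpa using hu, by simpa using hv.symm⟩, h.symm⟩
  have hEN' (u v : V) : E u ≠ Nb v (τ (χ u)) := fun h => by
    obtain ⟨w, hw⟩ := nonempty_iff_ne_empty.2 (hE0 u)
    refine hEN u v w ?_ ?_ h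
    · rw [← hRE] at hw; exact ((hNb _ _ _).1 (mem_sdiff.1 hw).1).1
    · rw [h] at hw; exact ((hNb _ _ _).1 hw).1
  let F : Finset (Sym2 V) := univ.biUnion fun v => (R v).image fun w => s(v, w)
  have hF (v w : V) : s(v, w) ∈ F ↔ w ∈ R v ∨ v ∈ R w := by
    simp only [F, mem_biUnion, mem_univ, true_and, mem_image, Sym2.eq_iff]
    constructor
    · rintro ⟨x, y, hy, ⟨rfl, rfl⟩ | ⟨rfl, rfl⟩⟩
      · exact Or.inl hy
      · exact Or.inr hy
    · rintro (h | h)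
      · exact ⟨v, w, h, Or.inl ⟨rfl, rfl⟩⟩
      · exact ⟨w, v, h, Or.inr ⟨rfl, rfl⟩⟩
  have hown (v w : V) (h : χ w = τ (χ v)) : (H.Adj v w ∧ s(v, w) ∉ F) ↔ w ∈ E v := by
    rw [← hRE, mem_sdiff, hNb, hF]
    have : v ∉ R w := fun hv => hτ (χ v) (by rw [← h, ← (hRNb w v hv).2, ← h, ← (hRNb w v hv).2])
    tauto
  have hsep (u v : V) (h1 : τ (χ u) ≠ τ (χ v)) (h2 : τ (τ (χ u)) ≠ χ v) :
      ∃ w, χ w ∈ Set.range τ ∧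
        ¬((H.Adj u w ∧ s(u, w) ∉ F) ↔ (H.Adj v w ∧ s(v, w) ∉ F)) := by
    by_contra! hcon
    refine hEN' u v (Finset.ext fun w => ?_)
    by_cases hw : χ w = τ (χ u)
    · rw [← hown u w hw, hcon w ⟨_, hw.symm⟩, hNb, hF]
      have h3 : w ∉ R v := fun h => h1 (hw ▸ (hRNb v w h).2)
      have h4 : v ∉ R w := fun h => h2 (hw ▸ (hRNb w v h).2.symm)
      tauto
    · rw [← hRE, mem_sdiff, hNb, hNb]; tauto
  refine ⟨F, ?_, ?_, fun v => ?_, fun u v huv => ?_⟩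
  · intro e he
    obtain ⟨v, -, hv⟩ := mem_biUnion.1 (mem_coe.1 he)
    obtain ⟨w, hw, rfl⟩ := mem_image.1 hv
    exact (hRNb v w hw).1
  · refine card_biUnion_le_card_mul _ _ s fun v _ => card_image_le.trans ?_
    exact (card_le_card (hRA v)).trans (hAs v).le
  -- `E v` differs from the whole of `Nb v (τ (χ v))`, so some edge at `v` is deleted.
  · have : R v ≠ ∅ := fun h => hEN' v v (by rw [← hRE v, h, sdiff_empty])
    obtain ⟨w, hw⟩ := nonempty_iff_ne_empty.2 this
    exact ⟨w, (hRNb v w hw).2, (hF v w).2 (Or.inl hw)⟩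
  · by_cases h1 : τ (χ u) = τ (χ v)
    · by_contra! hcon
      refine huv (hEinj (Finset.ext fun w => ?_))
      by_cases hw : χ w = τ (χ u)
      · rw [← hown u w hw, hcon w ⟨_, hw.symm⟩, hown v w (hw.trans h1)]
      · rw [← hRE, ← hRE, mem_sdiff, mem_sdiff, hNb, hNb, ← h1]; tauto
    · by_cases h2 : τ (τ (χ u)) = χ v
      · obtain ⟨w, hw, h⟩ := hsep v u (Ne.symm h1) (by rw [← h2]; exact hτ _)
        exact ⟨w, hw, fun h' => h h'.symm⟩
      · exact hsep u v h1 h2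

/-- Some three cyclically consecutive colour classes contain at most a fraction `3 / m` of the
vertices. -/
theorem exists_rotation_le {V : Type*} [Fintype V] {m : ℕ} [NeZero m] (χ : V → ZMod m) :
    ∃ j : ZMod m, m * #{w | χ w = j ∨ χ w = j + 1 ∨ χ w = j + 2} ≤ 3 * Fintype.card V := by
  classical
  have hsum (r : ZMod m) : ∑ j : ZMod m, #{w | χ w = j + r} = Fintype.card V := by
    refine (Equiv.sum_comp (Equiv.addRight r) fun j => #{w | χ w = j}).trans ?_
    rw [← card_univ]
    exact (card_eq_sum_card_fiberwise fun _ _ => mem_univ _).symm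
  have h : ∑ j : ZMod m, m * #{w | χ w = j ∨ χ w = j + 1 ∨ χ w = j + 2} ≤
      ∑ _j : ZMod m, 3 * Fintype.card V := by
    rw [← mul_sum, sum_const, card_univ, ZMod.card, smul_eq_mul]
    refine Nat.mul_le_mul_left _ ?_
    calc _ ≤ ∑ j : ZMod m, (#{w | χ w = j + 0} + #{w | χ w = j + 1} + #{w | χ w = j + 2}) := by
          refine sum_le_sum fun j _ => ?_
          rw [filter_or, filter_or, add_zero, add_assoc]
          exact (card_union_le _ _).trans (Nat.add_le_add_left (card_union_le _ _) _)
      _ = _ := by rw [sum_add_distrib, sum_add_distrib, hsum, hsum, hsum]; ring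
  obtain ⟨j, -, hj⟩ := exists_le_of_sum_le univ_nonempty h
  exact ⟨j, hj⟩

/-- The map that cycles `j → j + 1 → j + 2 → j` and sends all other colours to `j`. -/
theorem exists_map_range_rotation {m : ℕ} (hm : 3 ≤ m) (j : ZMod m) :
    ∃ τ : ZMod m → ZMod m, (∀ i, τ (τ (τ (τ i))) ≠ i) ∧
      ∀ i ∈ Set.range τ, i = j ∨ i = j + 1 ∨ i = j + 2 := by
  have h1 : (1 : ZMod m) ≠ 0 := by
    intro h
    have := (ZMod.natCast_eq_zero_iff 1 m).1 (by exact_mod_cast h)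
    have := Nat.le_of_dvd one_pos this
    omega
  have h2 : (2 : ZMod m) ≠ 0 := by
    intro h
    have := (ZMod.natCast_eq_zero_iff 2 m).1 (by exact_mod_cast h)
    have := Nat.le_of_dvd two_pos this
    omega
  have h21 : (2 : ZMod m) ≠ 1 := fun h => h1 (by linear_combination h)
  refine ⟨fun i => if i = j then j + 1 else if i = j + 1 then j + 2 else j, fun i => ?_, ?_⟩
  · by_cases ha : i = j
    · simp [ha, h1, h2, h21]
    · by_cases hb : i = j + 1
      · simp [hb, h1, h2, h21]
      · simp only [ha, hb, if_true, if_false]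
        simp [h1, h2, h21, Ne.symm ha]
  · rintro _ ⟨i, rfl⟩
    dsimp only
    split_ifs <;> simp

/-! ### Choice of the parameters -/

/-- The number `m` of colours is about `(d + 1) / (22 log (D + 1))`, so that the tail
`(1 - 1 / (2m)) ^ d` is at most `(D + 1) ^ (-10)`, while `2 ^ s` is about `(D + 1) ^ 2`. The
constant `66 = 3 * 22` is what leaves room for three colours. -/
theorem exists_parameters {d D : ℕ} (hdD : d ≤ D) (hD : 2 ≤ D)
    (hd : 66 * Real.log (D + 1) ≤ d + 1) :
    ∃ s m : ℕ, 3 ≤ m ∧ D ^ 2 + D + 1 ≤ 2 ^ s ∧ (s : ℝ) ≤ 5 * Real.log (D + 1) ∧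
      (d + 1 : ℝ) ≤ 44 * Real.log (D + 1) * m ∧
      4 * (D : ℝ) ^ 2 * (m * 2 ^ s * (1 - 1 / (2 * m)) ^ d) ≤ 1 := by
  set L := Real.log (D + 1)
  have hD' : (2 : ℝ) ≤ D := by exact_mod_cast hD
  have hexp : Real.exp L = D + 1 := Real.exp_log (by positivity)
  have hL1 : 1 ≤ L := by
    rw [Real.le_log_iff_exp_le (by positivity)]
    linarith [Real.exp_one_lt_d9]
  have hx : 3 ≤ (d + 1) / (22 * L) := by
    rw [le_div_iff₀ (by positivity)]; linarith
  set m := ⌊(d + 1) / (22 * L)⌋₊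
  have hm3 : 3 ≤ m := Nat.le_floor (by exact_mod_cast hx)
  have hm3' : (3 : ℝ) ≤ m := by exact_mod_cast hm3
  have hm1 : (m : ℝ) * (22 * L) ≤ d + 1 := by
    rw [← le_div_iff₀ (by positivity)]
    exact Nat.floor_le (by linarith)
  have hm2 : (d + 1 : ℝ) < (m + 1) * (22 * L) := by
    rw [← div_lt_iff₀ (by positivity)]
    exact Nat.lt_floor_add_one _
  have hs1 : (D + 1) ^ 2 ≤ 2 ^ Nat.clog 2 ((D + 1) ^ 2) := Nat.le_pow_clog one_lt_two _
  have hs2 : 2 ^ Nat.clog 2 ((D + 1) ^ 2) ≤ 2 * (D + 1) ^ 2 := by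
    have h := Nat.pow_pred_clog_lt_self one_lt_two (x := (D + 1) ^ 2) (by nlinarith)
    have h0 : 0 < Nat.clog 2 ((D + 1) ^ 2) := Nat.clog_pos one_lt_two (by nlinarith)
    obtain ⟨c, hc⟩ := Nat.exists_eq_succ_of_ne_zero h0.ne'
    rw [hc] at h ⊢
    simp only [Nat.succ_eq_add_one, Nat.pred_eq_sub_one, Nat.add_sub_cancel] at h
    rw [pow_succ]
    omega
  set s := Nat.clog 2 ((D + 1) ^ 2)
  have hs2' : (2 : ℝ) ^ s ≤ 2 * (D + 1) ^ 2 := by exact_mod_cast hs2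
  refine ⟨s, m, hm3, by nlinarith, ?_, by nlinarith, ?_⟩
  · have h := Real.log_le_log (by positivity) hs2'
    rw [Real.log_mul (by norm_num) (by positivity), Real.log_pow, Real.log_pow] at h
    push_cast at h
    have hl : 0.6931471803 < Real.log 2 := Real.log_two_gt_d9
    have hu : Real.log 2 < 0.6931471808 := Real.log_two_lt_d9
    change s * Real.log 2 ≤ Real.log 2 + 2 * L at h
    have : (s : ℝ) * 0.6931471803 ≤ s * Real.log 2 := by gcongr
    linarith
  · have hmD : (m : ℝ) ≤ D + 1 := by
      have : (d : ℝ) ≤ D := by exact_mod_cast hdD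
      nlinarith
    have h0 : 0 ≤ (1 - 1 / (2 * m) : ℝ) := by
      rw [sub_nonneg, div_le_one (by positivity)]; linarith
    have hpow : (1 - 1 / (2 * m) : ℝ) ^ d ≤ 1 / (D + 1) ^ 10 := by
      calc (1 - 1 / (2 * m) : ℝ) ^ d ≤ Real.exp (-(1 / (2 * m))) ^ d :=
            pow_le_pow_left₀ h0 (by linarith [Real.add_one_le_exp (-(1 / (2 * m) : ℝ))]) _
        _ = Real.exp (-(d / (2 * m))) := by rw [← Real.exp_nat_mul]; congr 1; ring
        _ ≤ Real.exp (-(10 * L)) := by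
            rw [Real.exp_le_exp, neg_le_neg_iff, le_div_iff₀ (by positivity)]
            nlinarith
        _ = 1 / (D + 1) ^ 10 := by
            rw [Real.exp_neg, show 10 * L = (10 : ℕ) * L by norm_num, Real.exp_nat_mul, hexp,
              one_div]
    calc 4 * (D : ℝ) ^ 2 * (m * 2 ^ s * (1 - 1 / (2 * m)) ^ d)
        ≤ 4 * (D + 1) ^ 2 * ((D + 1) * (2 * (D + 1) ^ 2) * (1 / (D + 1) ^ 10)) := by
          have h1 := pow_nonneg h0 d
          gcongr
          linarith
      _ = 8 / (D + 1 : ℝ) ^ 5 := by field_simp; norm_num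
      _ ≤ 1 := by
          rw [div_le_one (by positivity)]
          calc (8 : ℝ) ≤ 3 ^ 5 := by norm_num
            _ ≤ (D + 1) ^ 5 := by gcongr; linarith

/-! ### Identifying codes and the complement graph -/

/-- Closed neighbourhoods of `G ∪ F` are the complements of the open neighbourhoods of the
complement graph with `F` deleted. -/
theorem mem_closedNeighborhood_addEdges {V : Type*} (G : SimpleGraph V) {F : Set (Sym2 V)}
    (hF : F ⊆ Gᶜ.edgeSet) (v w : V) :
    w ∈ (G.addEdges F).closedNeighborhood v ↔ ¬(Gᶜ.Adj v w ∧ s(v, w) ∉ F) := by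
  have h1 : s(v, w) ∈ F → Gᶜ.Adj v w := fun h => hF h
  simp only [closedNeighborhood, addEdges, Set.mem_union, mem_neighborSet, sup_adj,
    fromEdgeSet_adj, Set.mem_singleton_iff, compl_adj] at h1 ⊢
  by_cases hvw : w = v
  · simp [hvw]
  · have := Ne.symm hvw
    tauto

theorem exists_identifyingCodeNumber_eq {V : Type*} {G : SimpleGraph V} {C : Finset V}
    (hC : G.IsIdentifyingCode (C : Set V)) :
    ∃ k : ℕ, G.identifyingCodeNumber = k ∧ k ≤ #C := by
  have h : G.identifyingCodeNumber ≤ #C := iInf₂_le C hC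
  obtain ⟨k, hk⟩ := ENat.ne_top_iff_exists.1 (ne_top_of_le_ne_top (ENat.natCast_ne_top _) h)
  exact ⟨k, hk.symm, by rw [← hk] at h; exact_mod_cast h⟩

/-- The theorem in terms of degree bounds `d` and `D` for the complement graph. The code consists of
three colour classes that contain all colours in the range of `τ`. -/
theorem exists_addEdges_identifyingCode {V : Type*} [Fintype V] (G : SimpleGraph V)
    [DecidableRel Gᶜ.Adj] {d D : ℕ} (hD : 2 ≤ D) (hdD : d ≤ D)
    (hdeg : ∀ v, d ≤ Gᶜ.degree v ∧ Gᶜ.degree v ≤ D)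
    (hd : 66 * Real.log (D + 1) ≤ d + 1) :
    ∃ F : Finset (Sym2 V), (F : Set (Sym2 V)) ⊆ Gᶜ.edgeSet ∧
      (#F : ℝ) ≤ 5 * (Fintype.card V * Real.log (D + 1)) ∧
      ∃ C : Finset V, (G.addEdges F).IsIdentifyingCode (C : Set V) ∧
        (#C : ℝ) ≤ 132 * (Fintype.card V * Real.log (D + 1) / (d + 1)) := by
  classical
  obtain ⟨s, m, hm, hs, hsL, hmd, hp⟩ := exists_parameters hdD hD hd
  have : NeZero m := ⟨by omega⟩
  obtain ⟨χ, hχ⟩ := exists_coloring_forall_frequent (α := ZMod m) Gᶜ (s := s)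
    (by omega) hdeg (by rw [ZMod.card]; exact hp)
  obtain ⟨j, hj⟩ := exists_rotation_le χ
  obtain ⟨τ, hτ, hrange⟩ := exists_map_range_rotation hm j
  obtain ⟨F, hFG, hFcard, hdom, hsep⟩ := exists_separating_deletion Gᶜ χ τ hτ (D := D) (by omega)
    (fun v => (hdeg v).2) hs fun v => hχ v _
  set C : Finset V := {w | χ w = j ∨ χ w = j + 1 ∨ χ w = j + 2}
  have hC (w : V) (h : χ w ∈ Set.range τ) : w ∈ (C : Set V) := by
    simpa [C] using hrange _ h
  refine ⟨F, hFG, ?_, C, ⟨fun v _ => ?_, fun u v huv h => ?_⟩, ?_⟩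
  · calc (#F : ℝ) ≤ Fintype.card V * s := by exact_mod_cast hFcard
      _ ≤ Fintype.card V * (5 * Real.log (D + 1)) := by gcongr
      _ = _ := by ring
  · obtain ⟨w, hw, hvw⟩ := hdom v
    refine ⟨w, hC w ⟨_, hw.symm⟩, Or.inr ?_⟩
    rw [fromEdgeSet_adj]
    exact ⟨hvw, (show Gᶜ.Adj v w from hFG hvw).ne⟩
  · obtain ⟨w, hw, hne⟩ := hsep u v huv
    have h1 := Set.ext_iff.1 h w
    simp only [Set.mem_inter_iff, hC w hw, and_true, mem_closedNeighborhood_addEdges G hFG,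
      mem_coe] at h1
    exact hne (not_iff_not.1 h1)
  · have hj' : (m : ℝ) * #C ≤ 3 * Fintype.card V := by exact_mod_cast hj
    have hL : 0 ≤ Real.log (D + 1) := Real.log_nonneg (by linarith [(D.cast_nonneg : (0 : ℝ) ≤ D)])
    rw [← mul_div_assoc, le_div_iff₀ (by positivity)]
    calc (#C : ℝ) * (d + 1) ≤ #C * (44 * Real.log (D + 1) * m) := by gcongr
      _ = 44 * Real.log (D + 1) * (m * #C) := by ring
      _ ≤ 44 * Real.log (D + 1) * (3 * Fintype.card V) := by gcongr
      _ = _ := by ring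

end SimpleGraph

theorem corollary7 :
    ∃ M K₁ K₂ : ℝ, 0 < M ∧ 0 < K₁ ∧ 0 < K₂ ∧
      ∀ (V : Type*) [Fintype V] (G : SimpleGraph V) [DecidableRel G.Adj] (n : ℕ),
        Fintype.card V = n →
        M ≤ (n : ℝ) - G.minDegree →
        66 * Real.log ((n : ℝ) - G.minDegree) ≤ (n : ℝ) - G.maxDegree →
        ∃ F : Finset (Sym2 V),
          (F : Set (Sym2 V)) ⊆ (Gᶜ).edgeSet ∧
          (F.card : ℝ) ≤ K₁ * (n * Real.log ((n : ℝ) - G.minDegree)) ∧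
          ∃ k : ℕ, (G.addEdges F).identifyingCodeNumber = k ∧
            (k : ℝ) ≤ K₂ * (n * Real.log n / ((n : ℝ) - G.maxDegree)) := by
  refine ⟨3, 5, 132, by norm_num, by norm_num, by norm_num, ?_⟩
  rintro V _ G _ n rfl hM hΔ
  classical
  have : Nonempty V := by
    rw [← Fintype.card_pos_iff, ← Nat.cast_pos (α := ℝ)]
    linarith [(G.minDegree.cast_nonneg : (0 : ℝ) ≤ G.minDegree)]
  have hmax : G.maxDegree < Fintype.card V := G.maxDegree_lt_card_verts
  have hle : G.minDegree ≤ G.maxDegree := G.minDegree_le_maxDegree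
  obtain ⟨D, hD⟩ : ∃ D, Fintype.card V = G.minDegree + (D + 1) :=
    ⟨Fintype.card V - G.minDegree - 1, by omega⟩
  obtain ⟨d, hd⟩ : ∃ d, Fintype.card V = G.maxDegree + (d + 1) :=
    ⟨Fintype.card V - G.maxDegree - 1, by omega⟩
  have hD' : (Fintype.card V : ℝ) - G.minDegree = D + 1 := by rw [hD]; push_cast; ring
  have hd' : (Fintype.card V : ℝ) - G.maxDegree = d + 1 := by rw [hd]; push_cast; ring
  rw [hD'] at hM hΔ ⊢
  rw [hd'] at hΔ ⊢
  have hD2 : 2 ≤ D := by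
    have : (2 : ℝ) ≤ D := by linarith
    exact_mod_cast this
  obtain ⟨F, hF, hFcard, C, hC, hCcard⟩ := G.exists_addEdges_identifyingCode hD2 (by omega)
    (fun v => by
      have h1 := G.minDegree_le_degree v
      have h2 := G.degree_le_maxDegree v
      rw [SimpleGraph.degree_compl]
      omega) hΔ
  obtain ⟨k, hk, hkC⟩ := SimpleGraph.exists_identifyingCodeNumber_eq hC
  refine ⟨F, hF, hFcard, k, hk, (Nat.cast_le.2 hkC).trans (hCcard.trans ?_)⟩
  have hDn : (D + 1 : ℝ) ≤ Fintype.card V := by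
    rw [hD]
    push_cast
    linarith [(G.minDegree.cast_nonneg : (0 : ℝ) ≤ G.minDegree)]
  gcongr
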